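/- Let $\lambda$ be an infinite cardinal (identified with its initial von Neumann ordinal). For every $A \subseteq \lambda$ there is a function $f : {}^{\omega}\lambda \to \omega$, defined on the set ${}^{\omega}\lambda$ of all functions from $\omega$ to $\lambda$, with the following property. Let $M$ be any transitive model of $\mathrm{ZF}$ (a set or a proper class) with $\lambda \in M$, and let $({}^{\omega}\lambda)^M = {}^{\omega}\lambda \cap M$ be the set of all functions from $\omega$ to $\lambda$ that belong to $M$. If there is a function $g : ({}^{\omega}\lambda)^M \to \omega$ with $g \in M$ such that $f(x) \le g(x)$ for all $x \in ({}^{\omega}\lambda)^M$, then $A \in M$. -/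

import Mathlib

universe u

namespace SetModel

open FirstOrder FirstOrder.Language

/-- The relation symbols of the language of set theory: one binary symbol for membership. -/
inductive SetRel : ℕ → Type
  | mem : SetRel 2

/-- The first-order language of set theory. -/
def LSet : FirstOrder.Language.{0, 0} := ⟨fun _ => Empty, SetRel⟩

/-- Every class `M` of sets, regarded as the structure `⟨M, ∈⟩`. -/
instance (M : Set ZFSet.{u}) : LSet.Structure M where
  funMap := fun f => f.elim
  RelMap := fun {_} r => match r with
    | SetRel.mem => fun x => (x 0 : ZFSet.{u}) ∈ (x 1 : ZFSet.{u})

/-- The atomic formula `vᵢ ∈ vⱼ`. In a bounded formula, `v₀` is the variable bound by the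
outermost quantifier, `v₁` the variable bound by the next one, and so on. -/
def memF {α : Type} {n : ℕ} (i j : Fin n) : LSet.BoundedFormula α n :=
  Relations.boundedFormula₂ (L := LSet) SetRel.mem (&i) (&j)

/-- The atomic formula `vᵢ = vⱼ`. -/
def eqF {α : Type} {n : ℕ} (i j : Fin n) : LSet.BoundedFormula α n :=
  (&i) =' (&j)

/-- Two sets with the same elements are equal. -/
def extensionality : LSet.Sentence :=
  ∀' (∀' ((∀' (memF 2 0 ⇔ memF 2 1)) ⟹ eqF 0 1))

/-- Every nonempty set `v₀` has an element `v₁` that is disjoint from `v₀`. -/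
def foundation : LSet.Sentence :=
  ∀' ((∃' (memF 1 0)) ⟹ (∃' (memF 1 0 ⊓ (∀' (memF 2 1 ⟹ ∼(memF 2 0))))))

/-- The unordered pair `v₂ = {v₀, v₁}` exists. -/
def pairing : LSet.Sentence :=
  ∀' (∀' (∃' (∀' (memF 3 2 ⇔ (eqF 3 0 ⊔ eqF 3 1)))))

/-- The union `v₁ = ⋃ v₀` exists. -/
def union : LSet.Sentence :=
  ∀' (∃' (∀' (memF 2 1 ⇔ (∃' (memF 3 0 ⊓ memF 2 3)))))

/-- The power set `v₁` of `v₀` exists. -/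
def powerset : LSet.Sentence :=
  ∀' (∃' (∀' (memF 2 1 ⇔ (∀' (memF 3 2 ⟹ memF 3 0)))))

/-- There is a set `v₀` that contains the empty set and contains `v₂ = v₁ ∪ {v₁}` for each of its
elements `v₁`. -/
def infinity : LSet.Sentence :=
  ∃' ((∃' (memF 1 0 ⊓ (∀' ∼(memF 2 1)))) ⊓
    (∀' (memF 1 0 ⟹ (∃' (memF 2 0 ⊓ (∀' (memF 3 2 ⇔ (memF 3 1 ⊔ eqF 3 1))))))))

/-- The instance of separation for `φ(x, p)`, where `p` is a tuple of `k` parameters: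
for all `p` and `v₀` the set `v₁ = {v₂ ∈ v₀ | φ(v₂, p)}` exists. -/
noncomputable def separation {k : ℕ} (φ : LSet.BoundedFormula (Empty ⊕ Fin k) 1) : LSet.Sentence :=
  Formula.iAlls (α := Empty) (Fin k)
    (∀' (∃' (∀' (memF 2 1 ⇔ (memF 2 0 ⊓ φ.liftAt 2 0)))))

/-- The instance of replacement for `φ(x, y, p)`, where `p` is a tuple of `k` parameters:
for all `p` and `v₀`, if for every `v₁ ∈ v₀` there is at most one `y` with `φ(v₁, y, p)`
(`φ(v₁, v₂, p)` and `φ(v₁, v₃, p)` imply `v₂ = v₃`), then there is a set `v₁` such that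
`φ(v₂, v₃, p)` and `v₂ ∈ v₀` imply `v₃ ∈ v₁`. -/
noncomputable def replacement {k : ℕ} (φ : LSet.BoundedFormula (Empty ⊕ Fin k) 2) :
    LSet.Sentence :=
  Formula.iAlls (α := Empty) (Fin k)
    (∀' ((∀' (memF 1 0 ⟹ (∀' (∀' ((φ.liftAt 1 0).liftAt 1 3 ⟹
          ((φ.liftAt 1 0).liftAt 1 2 ⟹ eqF 2 3)))))) ⟹
      (∃' (∀' (memF 2 0 ⟹ (∀' (φ.liftAt 2 0 ⟹ memF 3 1)))))))

/-- Zermelo–Fraenkel set theory (without choice). -/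
def ZF : LSet.Theory :=
  {extensionality, foundation, pairing, union, powerset, infinity} ∪
    {σ | ∃ (k : ℕ) (φ : LSet.BoundedFormula (Empty ⊕ Fin k) 1), σ = separation φ} ∪
    {σ | ∃ (k : ℕ) (φ : LSet.BoundedFormula (Empty ⊕ Fin k) 2), σ = replacement φ}

/-- `M` (a set or a proper class) is a transitive model of `ZF`. -/
structure IsTransitiveModelZF (M : Set ZFSet.{u}) : Prop where
  transitive : ∀ x ∈ M, ∀ y ∈ x, y ∈ M
  models : M ⊨ ZF

/-- The set of functions from `x` to `y` in the sense of the transitive model `M`, that is, the set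
of those functions from `x` to `y` that are elements of `M`. -/
noncomputable def funsIn (M : Set ZFSet.{u}) (x y : ZFSet.{u}) : ZFSet.{u} :=
  ZFSet.sep (fun h => h ∈ M) (ZFSet.funs x y)

/-- The set `ω` of the finite von Neumann ordinals. -/
noncomputable def omegaSet : ZFSet.{u} := Ordinal.omega0.toZFSet

/-- An infinite cardinal as a set: its initial ordinal, as a von Neumann ordinal. -/
noncomputable def cardSet (c : Cardinal.{u}) : ZFSet.{u} := c.ord.toZFSet

/-- `f(x) ≤ g(x)` for all `x` in `D`, where `f` and `g` are set-theoretic functions that are defined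
on `D` and have ordinals as values (`≤` is inclusion of von Neumann ordinals). -/
def DominatedOn (D f g : ZFSet.{u}) : Prop :=
  ∀ x ∈ D, ∀ m n : ZFSet.{u}, ZFSet.pair x m ∈ f → ZFSet.pair x n ∈ g → m ⊆ n

end SetModel

/-!
Fix `A ⊆ λ`. The function `f` sends `x : ω → λ` to the first `j` such that exactly one of
`x(0)`, `x(j)` is in `A` (and to `0` if there is none).

Let `M` be a transitive model and let `g ∈ M` dominate `f` on the sequences of `M`. Call `B ⊆ λ`
*good* (`Good`) if no sequence `β ∈ M` has its first change of membership in `B` at a place beyond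
`g(β)`. So `A` is good. Good sets are taken in the universe, not in `M`; they form a closed subset
of `2^λ`, since badness is witnessed by finitely many membership facts.

* By compactness of `2^λ`, whether finitely many membership facts can be realised by a good set is
  expressible in `M` (`exists_good_iff`): only finite approximations to a good set have to be
  quantified over, and these belong to `M`.
* The family of good sets is finite, in the form `finDet_zero`: there is a finite `F ⊆ λ` such that
  good sets with the same trace on `F` are equal. Otherwise `M` can run the following recursion. A
  finite condition that does not determine its good extensions up to finitely many choices splits
  at some ordinal; take the least one, and decide it so that the condition stays undetermined. The
  recursion is definable and makes no choices, hence gives `α₀, α₁, …` and bits `z₀, z₁, …` in `M`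
  such that for every `n` a good set follows the bits below `n` and deviates at `n`. One bit value
  occurs infinitely often; the sequence `β ∈ M` of the corresponding `αₙ`, padded by one of them,
  has its first change at arbitrarily large places, with respect to suitable good sets. This
  contradicts the bound `g(β)`.
* Therefore `A` is the only good set with its own trace on `F`, and `ξ ∈ A` says that some good set
  with this trace contains `ξ`. This is definable over `M`, so `A ∈ M` by separation
  (`Good.exists_tr_eq`).

Choice in `M` is not needed, since all searches are over finite sets of ordinals or for least
ordinals.

Definability over `M` is handled by a small many-sorted calculus. The sorts (`Srt`) are `M`, `ℕ`,
the elements of `λ`, and the sequences `ω → λ` in `M`; contexts (`Ctx`) are iterated products of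
sorts, and instance search derives definability of predicates (`Def`) and functions (`Tm`) from
the way they are written.
-/

open FirstOrder FirstOrder.Language

universe v w

namespace SetModel

/-! ### Closure properties of transitive models -/

/-- The closure properties of a transitive class that the argument uses. Separation is stated for
Mathlib's notion of a set definable with parameters. -/
class IsModel (M : Set ZFSet.{u}) : Prop where
  trans : ∀ x ∈ M, ∀ y ∈ x, y ∈ M
  pair_mem : ∀ x ∈ M, ∀ y ∈ M, ({x, y} : ZFSet.{u}) ∈ M
  pow : ∀ x ∈ M, ∃ y ∈ M, ∀ z ∈ M, z ⊆ x → z ∈ y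
  sep : ∀ S : Set (Unit → M), (Set.univ : Set M).Definable LSet S → ∀ a : M, ∃ b : M,
    ∀ x : M, x.1 ∈ b.1 ↔ x.1 ∈ a.1 ∧ (fun _ => x) ∈ S
  omega_mem : omegaSet ∈ M

section Realize
variable {M : Set ZFSet.{u}} {α : Type} {n : ℕ}

@[simp] theorem realize_memF (v : α → M) (xs : Fin n → M) (i j : Fin n) :
    (memF i j : LSet.BoundedFormula α n).Realize v xs ↔ (xs i).1 ∈ (xs j).1 :=
  Iff.rfl

@[simp] theorem realize_eqF (v : α → M) (xs : Fin n → M) (i j : Fin n) :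
    (eqF i j : LSet.BoundedFormula α n).Realize v xs ↔ xs i = xs j := by
  rw [eqF]; simp

end Realize

section ofZF
variable {M : Set ZFSet.{u}}

theorem ext_of_trans (ht : ∀ x ∈ M, ∀ y ∈ x, y ∈ M) {x y : ZFSet.{u}} (hx : x ∈ M) (hy : y ∈ M)
    (h : ∀ z ∈ M, z ∈ x ↔ z ∈ y) : x = y := by
  ext z
  exact ⟨fun hz => (h z (ht x hx z hz)).1 hz, fun hz => (h z (ht y hy z hz)).2 hz⟩

theorem IsTransitiveModelZF.pair_mem (hM : IsTransitiveModelZF M) (x : ZFSet.{u}) (hx : x ∈ M)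
    (y : ZFSet.{u}) (hy : y ∈ M) : ({x, y} : ZFSet.{u}) ∈ M := by
  have h : M ⊨ pairing := hM.models.realize_of_mem _ (by simp [ZF])
  simp only [pairing, Sentence.Realize, Formula.Realize, BoundedFormula.realize_all,
    BoundedFormula.realize_ex, BoundedFormula.realize_iff, BoundedFormula.realize_sup,
    realize_memF, realize_eqF] at h
  obtain ⟨z, hz⟩ := h ⟨x, hx⟩ ⟨y, hy⟩
  suffices z.1 = {x, y} by rw [← this]; exact z.2
  ext w
  have key : ∀ w : M, w.1 ∈ z.1 ↔ w = ⟨x, hx⟩ ∨ w = ⟨y, hy⟩ := fun w => hz w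
  rw [ZFSet.mem_pair]
  constructor
  · intro hw
    have := (key ⟨w, hM.transitive _ z.2 _ hw⟩).1 hw
    simpa [Subtype.ext_iff] using this
  · rintro (rfl | rfl)
    · exact (key ⟨w, hx⟩).2 (Or.inl rfl)
    · exact (key ⟨w, hy⟩).2 (Or.inr rfl)

theorem IsTransitiveModelZF.pow (hM : IsTransitiveModelZF M) (x : ZFSet.{u}) (hx : x ∈ M) :
    ∃ y ∈ M, ∀ z ∈ M, z ⊆ x → z ∈ y := by
  have h : M ⊨ powerset := hM.models.realize_of_mem _ (by simp [ZF])
  simp only [powerset, Sentence.Realize, Formula.Realize, BoundedFormula.realize_all,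
    BoundedFormula.realize_ex, BoundedFormula.realize_iff, BoundedFormula.realize_imp,
    realize_memF] at h
  obtain ⟨y, hy⟩ := h ⟨x, hx⟩
  refine ⟨y.1, y.2, fun z hz hzx => ?_⟩
  exact (hy ⟨z, hz⟩).2 fun w hw => hzx hw

/-- Separation for definable sets: a definition with parameters from `M` involves finitely many of
them, so it becomes a formula with parameters indexed by some `Fin k`. -/
theorem IsTransitiveModelZF.sep (hM : IsTransitiveModelZF M) (S : Set (Unit → M))
    (hS : (Set.univ : Set M).Definable LSet S) (a : M) : ∃ b : M,
    ∀ x : M, x.1 ∈ b.1 ↔ x.1 ∈ a.1 ∧ (fun _ => x) ∈ S := by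
  obtain ⟨A0, -, hA0⟩ := Set.definable_iff_finitely_definable.1 hS
  obtain ⟨φ, rfl⟩ := Set.definable_iff_exists_formula_sum.1 hA0
  let e : (A0 : Set M) ≃ Fin A0.card := A0.equivFin
  let ψ : LSet.BoundedFormula (Empty ⊕ Fin A0.card) 1 :=
    BoundedFormula.relabel (n := 1) (k := 0) (fun i : (A0 : Set M) ⊕ Unit =>
      i.elim (fun p => Sum.inl (Sum.inr (e p))) (fun _ => Sum.inr 0)) φ
  have h : M ⊨ separation ψ :=
    hM.models.realize_of_mem _ (Or.inl (Or.inr ⟨_, ψ, rfl⟩))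
  simp only [separation, Sentence.Realize, Formula.realize_iAlls] at h
  have h := h (fun i => (e.symm i).1)
  simp only [Formula.Realize, BoundedFormula.realize_all,
    BoundedFormula.realize_ex, BoundedFormula.realize_iff, BoundedFormula.realize_inf,
    realize_memF] at h
  obtain ⟨b, hb⟩ := h a
  refine ⟨b, fun x => ?_⟩
  refine (hb x).trans (and_congr Iff.rfl ?_)
  rw [BoundedFormula.realize_liftAt (by simp)]
  simp only [ψ]
  rw [BoundedFormula.realize_relabel]
  simp only [Set.mem_ofPred_eq, Formula.Realize]
  refine iff_of_eq (congr_arg₂ _ ?_ (Subsingleton.elim _ _))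
  funext i
  rcases i with p | i
  · simp
  · rfl

theorem IsTransitiveModelZF.isModel (hM : IsTransitiveModelZF M) {lam : Cardinal.{u}}
    (hlam : Cardinal.aleph0 ≤ lam) (hl : cardSet lam ∈ M) : IsModel M where
  trans := hM.transitive
  pair_mem := hM.pair_mem
  pow := hM.pow
  sep := hM.sep
  omega_mem := by
    have h : Ordinal.omega0 ≤ lam.ord := by simpa using Cardinal.ord_le_ord.2 hlam
    rcases h.lt_or_eq with h | h
    · exact hM.transitive _ hl _ (Ordinal.toZFSet_mem_toZFSet_iff.2 h)
    · rw [omegaSet, h]; exact hl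

end ofZF

/-! ### Definability over `M` -/

section Definability

/-- A sort of the definability calculus: a type whose elements are represented by elements of `M`,
with a definable set of representatives. -/
class Srt (M : Set ZFSet.{u}) (τ : Type v) where
  enc : τ → M
  inj : Function.Injective enc
  range_def : (Set.univ : Set M).Definable LSet {x : Unit → M | ∃ y, enc y = x ()}

/-- A context of the definability calculus: a type whose elements are represented by finite tuples
of elements of `M`. -/
class Ctx (M : Set ZFSet.{u}) (Γ : Type w) where
  ι : Type
  fin : Finite ι
  enc : Γ → ι → M

variable {M : Set ZFSet.{u}} {Γ : Type w} {τ : Type v}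

instance : Srt M M where
  enc := id
  inj := Function.injective_id
  range_def := by simp

instance : Ctx M Unit where
  ι := Empty
  fin := inferInstance
  enc := fun _ i => i.elim

instance [Ctx M Γ] [Srt M τ] : Ctx M (Γ × τ) where
  ι := Option (Ctx.ι M Γ)
  fin := by have := Ctx.fin (M := M) (Γ := Γ); infer_instance
  enc := fun p o => o.elim (Srt.enc p.2) (Ctx.enc p.1)

/-- The predicate `P` is definable over `⟨M, ∈⟩` with parameters. A class, so that definability is
derived by instance search. -/
class Def (M : Set ZFSet.{u}) {Γ : Type w} [Ctx M Γ] (P : Γ → Prop) : Prop where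
  out : ∃ S : Set (Ctx.ι M Γ → M), (Set.univ : Set M).Definable LSet S ∧
    ∀ γ, P γ ↔ Ctx.enc γ ∈ S

/-- The function `t` has a graph definable over `⟨M, ∈⟩` with parameters. -/
class Tm (M : Set ZFSet.{u}) {Γ : Type w} {τ : Type v} [Ctx M Γ] [Srt M τ] (t : Γ → τ) : Prop where
  out : Def M (fun p : Γ × τ => t p.1 = p.2)

section Basic
variable [Ctx M Γ] [Srt M τ] {P Q : Γ → Prop}

theorem Def.congr (h : Def M Q) (hPQ : ∀ γ, P γ ↔ Q γ) : Def M P := by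
  obtain ⟨S, hS, h⟩ := h
  exact ⟨S, hS, fun γ => (hPQ γ).trans (h γ)⟩

instance Def.and [hP : Def M P] [hQ : Def M Q] : Def M (fun γ => P γ ∧ Q γ) := by
  obtain ⟨S, hS, h⟩ := hP
  obtain ⟨T, hT, h'⟩ := hQ
  exact ⟨S ∩ T, hS.inter hT, fun γ => and_congr (h γ) (h' γ)⟩

instance Def.not [hP : Def M P] : Def M (fun γ => ¬ P γ) := by
  obtain ⟨S, hS, h⟩ := hP
  exact ⟨Sᶜ, hS.compl, fun γ => not_congr (h γ)⟩

instance Def.const (p : Prop) : Def M (fun _ : Γ => p) := by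
  by_cases hp : p
  · exact ⟨Set.univ, Set.definable_univ, by simp [hp]⟩
  · exact ⟨∅, Set.definable_empty, by simp [hp]⟩

instance Def.or [hP : Def M P] [hQ : Def M Q] : Def M (fun γ => P γ ∨ Q γ) :=
  Def.congr (Q := fun γ => ¬ (¬ P γ ∧ ¬ Q γ)) inferInstance (by intro; tauto)

instance Def.imp [hP : Def M P] [hQ : Def M Q] : Def M (fun γ => P γ → Q γ) :=
  Def.congr (Q := fun γ => ¬ (P γ ∧ ¬ Q γ)) inferInstance (by intro; tauto)

instance Def.iff [hP : Def M P] [hQ : Def M Q] : Def M (fun γ => P γ ↔ Q γ) :=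
  Def.congr (Q := fun γ => (P γ → Q γ) ∧ (Q γ → P γ)) inferInstance (by intro; tauto)

instance Def.ex {P : Γ → τ → Prop} [hP : Def M (fun p : Γ × τ => P p.1 p.2)] :
    Def M (fun γ => ∃ y, P γ y) := by
  obtain ⟨S, hS, h⟩ := hP
  have := Ctx.fin (M := M) (Γ := Γ)
  have : Finite (Ctx.ι M (Γ × τ)) := Ctx.fin
  let R : Set (Option (Ctx.ι M Γ) → M) :=
    (fun x => x ∘ fun _ => none) ⁻¹' {x : Unit → M | ∃ y : τ, Srt.enc y = x ()}
  have hR : (Set.univ : Set M).Definable LSet R := (Srt.range_def (M := M) (τ := τ)).preimage_comp _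
  refine ⟨_, (hS.inter hR).image_comp (some : Ctx.ι M Γ → Option (Ctx.ι M Γ)), fun γ => ?_⟩
  constructor
  · rintro ⟨y, hy⟩
    refine ⟨Ctx.enc (γ, y), ⟨(h (γ, y)).1 hy, ⟨y, rfl⟩⟩, rfl⟩
  · rintro ⟨x, ⟨hx, ⟨y, hy⟩⟩, hxγ⟩
    refine ⟨y, (h (γ, y)).2 ?_⟩
    convert hx using 1
    funext o
    rcases o with _ | i
    · exact hy
    · exact (congr_fun hxγ i).symm

instance Def.all {P : Γ → τ → Prop} [hP : Def M (fun p : Γ × τ => P p.1 p.2)] :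
    Def M (fun γ => ∀ y, P γ y) :=
  Def.congr (Q := fun γ => ¬ ∃ y, ¬ P γ y) inferInstance (by intro; simp)

/-- Definability is preserved by a map between contexts that permutes, drops or repeats
variables. -/
theorem Def.comap {Δ : Type*} [Ctx M Δ] (r : Δ → Γ) (f : Ctx.ι M Γ → Ctx.ι M Δ)
    (hf : ∀ δ i, Ctx.enc (M := M) (r δ) i = Ctx.enc δ (f i)) (hP : Def M P) :
    Def M (fun δ => P (r δ)) := by
  obtain ⟨S, hS, h⟩ := hP
  refine ⟨_, hS.preimage_comp f, fun δ => (h _).trans ?_⟩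
  rw [Set.mem_preimage]
  exact iff_of_eq (congr_arg (· ∈ S) (funext fun i => hf δ i))

variable {σ : Type*} [Srt M σ]

theorem Tm.wk {t : Γ → τ} (h : Tm M t) : Tm M (fun p : Γ × σ => t p.1) :=
  ⟨Def.comap (fun p : (Γ × σ) × τ => (p.1.1, p.2))
    (fun o : Option (Ctx.ι M Γ) => o.elim none fun i => some (some i))
    (by rintro ⟨⟨γ, y⟩, z⟩ (_ | i) <;> rfl) h.out⟩

theorem definable_eq {ι : Type} (i j : ι) :
    (Set.univ : Set M).Definable LSet {x : ι → M | x i = x j} :=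
  Set.definable_iff_exists_formula_sum.2
    ⟨(Term.var (Sum.inr i)).equal (Term.var (Sum.inr j)), by ext; simp⟩

theorem definable_mem {ι : Type} (i j : ι) :
    (Set.univ : Set M).Definable LSet {x : ι → M | (x i).1 ∈ (x j).1} :=
  Set.definable_iff_exists_formula_sum.2
    ⟨Relations.formula₂ (L := LSet) SetRel.mem (Term.var (Sum.inr i)) (Term.var (Sum.inr j)), by
      ext
      simp only [Set.mem_ofPred_eq]
      rfl⟩

theorem definable_eq_const {ι : Type} (i : ι) (a : M) :
    (Set.univ : Set M).Definable LSet {x : ι → M | x i = a} :=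
  Set.definable_iff_exists_formula_sum.2
    ⟨(Term.var (Sum.inr i)).equal (Term.var (Sum.inl ⟨a, trivial⟩)), by ext; simp⟩

instance Tm.var0 : Tm M (fun p : Γ × τ => p.2) :=
  ⟨⟨_, definable_eq (some none) none, fun _ => Srt.inj.eq_iff.symm⟩⟩

instance Tm.const (c : τ) : Tm M (fun _ : Γ => c) :=
  ⟨⟨_, definable_eq_const none (Srt.enc c), fun _ =>
    eq_comm.trans (Srt.inj (M := M) (τ := τ)).eq_iff.symm⟩⟩

/-- A map between contexts all of whose coordinates are definable. -/
class Sub (M : Set ZFSet.{u}) {Γ : Type w} {Δ : Type*} [Ctx M Γ] [Ctx M Δ] (r : Γ → Δ) : Prop where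
  out : ∀ i, Def M (fun p : Γ × M => (Ctx.enc (r p.1) i : M) = p.2)

/-- Definability is preserved by substituting definable functions for the variables. Instances for
a specific notion are proved for variables and then transferred by this lemma. -/
theorem Def.comp {Δ : Type*} [Ctx M Δ] {P : Δ → Prop} (hP : Def M P) (r : Γ → Δ)
    [hr : Sub M r] : Def M (fun γ => P (r γ)) := by
  have := Ctx.fin (M := M) (Γ := Γ)
  have := Ctx.fin (M := M) (Γ := Δ)
  obtain ⟨S, hS, h⟩ := hP
  choose T hT hT' using fun i => (hr.out i).out
  let f (i : Ctx.ι M Δ) : Option (Ctx.ι M Γ) → Ctx.ι M Γ ⊕ Ctx.ι M Δ :=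
    fun o => o.elim (Sum.inr i) Sum.inl
  have hU := (hS.preimage_comp (Sum.inr : _ → Ctx.ι M Γ ⊕ Ctx.ι M Δ)).inter
    (Set.definable_iInter_of_finite fun i => (hT i).preimage_comp (f i))
  refine ⟨_, hU.image_comp Sum.inl, fun γ => (h _).trans ⟨fun hγ => ?_, ?_⟩⟩
  · refine ⟨Sum.elim (Ctx.enc γ) (Ctx.enc (r γ)), ⟨hγ, Set.mem_iInter.2 fun i => ?_⟩, rfl⟩
    have hf : Ctx.enc (M := M) (γ, (Ctx.enc (r γ) i : M)) =
        Sum.elim (Ctx.enc γ) (Ctx.enc (r γ)) ∘ f i := by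
      funext o
      rcases o with _ | o <;> rfl
    rw [Set.mem_preimage, ← hf]
    exact (hT' i (γ, Ctx.enc (r γ) i)).1 rfl
  · rintro ⟨x, ⟨hx, hx'⟩, hxγ⟩
    have : Ctx.enc (r γ) = x ∘ Sum.inr := by
      funext i
      refine (hT' i (γ, x (Sum.inr i))).2 ?_
      have hf : Ctx.enc (M := M) (γ, x (Sum.inr i)) = x ∘ f i := by
        funext o
        rcases o with _ | o
        · rfl
        · exact (congr_fun hxγ o).symm
      rw [hf]
      exact Set.mem_iInter.1 hx' i
    rw [this]
    exact hx

instance Sub.unit (r : Γ → Unit) : Sub M r := ⟨fun i => i.elim⟩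

instance Sub.pair {Δ : Type*} [Ctx M Δ] {r : Γ → Δ} {t : Γ → τ} [hr : Sub M r] [ht : Tm M t] :
    Sub M (fun γ => (r γ, t γ)) where
  out := by
    rintro (_ | i)
    · have h : Def M (fun p : (Γ × M) × τ => t p.1.1 = p.2) :=
        ((Tm.wk (σ := M) ht).out)
      have h' : Def M (fun p : (Γ × M) × τ => Srt.enc p.2 = p.1.2) :=
        ⟨_, definable_eq none (some none), fun _ => Iff.rfl⟩
      exact Def.congr (Q := fun p : Γ × M => ∃ y : τ, t p.1 = y ∧ Srt.enc y = p.2)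
        inferInstance fun p => by simp [Ctx.enc]
    · exact hr.out i

theorem Tm.comp {Δ : Type*} [Ctx M Δ] {F : Δ → τ} (hF : Tm M F) (r : Γ → Δ) [hr : Sub M r] :
    Tm M (fun γ => F (r γ)) := by
  have : Sub M (fun p : Γ × τ => r p.1) :=
    ⟨fun i => Def.comap (fun p : (Γ × τ) × M => (p.1.1, p.2))
      (fun o : Option (Ctx.ι M Γ) => o.elim none fun i => some (some i))
      (by rintro ⟨⟨γ, y⟩, z⟩ (_ | i) <;> rfl) (hr.out i)⟩
  exact ⟨Def.comp (P := fun p : Δ × τ => F p.1 = p.2) hF.out (fun p : Γ × τ => (r p.1, p.2))⟩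

instance Def.eq {t s : Γ → τ} [Tm M t] [Tm M s] : Def M (fun γ => t γ = s γ) :=
  Def.comp (P := fun p : (Unit × τ) × τ => p.1.2 = p.2)
    ⟨_, definable_eq (some none) none, fun _ => (Srt.inj (M := M)).eq_iff.symm⟩
    (fun γ => (((), t γ), s γ))

instance Def.mem {t s : Γ → M} [Tm M t] [Tm M s] : Def M (fun γ => (t γ).1 ∈ (s γ).1) :=
  Def.comp (P := fun p : (Unit × M) × M => p.1.2.1 ∈ p.2.1)
    ⟨_, definable_mem (some none) none, fun _ => Iff.rfl⟩ (fun γ => (((), t γ), s γ))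

instance Tm.enc {t : Γ → τ} [Tm M t] : Tm M (fun γ => (Srt.enc (t γ) : M)) :=
  Tm.comp (F := fun p : Unit × τ => (Srt.enc p.2 : M))
    ⟨⟨_, definable_eq (some none) none, fun _ => Iff.rfl⟩⟩ (fun γ => ((), t γ))

variable {τ₁ τ₂ τ₃ τ₄ τ₅ τ₆ : Type*} [Srt M τ₁] [Srt M τ₂] [Srt M τ₃] [Srt M τ₄] [Srt M τ₅]
  [Srt M τ₆]

-- Instance search recognises a variable of a context as an iterated projection, one instance for
-- each depth that occurs.
instance Tm.var1 : Tm M (fun p : (Γ × τ) × τ₁ => p.1.2) := Tm.var0.wk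
instance Tm.var2 : Tm M (fun p : ((Γ × τ) × τ₁) × τ₂ => p.1.1.2) := Tm.var1.wk
instance Tm.var3 : Tm M (fun p : (((Γ × τ) × τ₁) × τ₂) × τ₃ => p.1.1.1.2) := Tm.var2.wk
instance Tm.var4 : Tm M (fun p : ((((Γ × τ) × τ₁) × τ₂) × τ₃) × τ₄ => p.1.1.1.1.2) := Tm.var3.wk
instance Tm.var5 : Tm M (fun p : (((((Γ × τ) × τ₁) × τ₂) × τ₃) × τ₄) × τ₅ => p.1.1.1.1.1.2) :=
  Tm.var4.wk
instance Tm.var6 : Tm M (fun p : ((((((Γ × τ) × τ₁) × τ₂) × τ₃) × τ₄) × τ₅) × τ₆ =>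
    p.1.1.1.1.1.1.2) := Tm.var5.wk

end Basic

end Definability

section Sorts
variable {M : Set ZFSet.{u}} {Γ : Type w} [Ctx M Γ]

theorem Srt.range_def_of {τ : Type*} {e : τ → M}
    (h : Def M (fun p : Unit × M => ∃ y, e y = p.2)) :
    (Set.univ : Set M).Definable LSet {x : Unit → M | ∃ y, e y = x ()} := by
  obtain ⟨S, hS, h⟩ := h
  have := hS.preimage_comp (fun _ : Option Empty => ())
  convert this using 1
  ext x
  refine (h ((), x ())).trans ?_
  rw [Set.mem_preimage]
  refine iff_of_eq (congr_arg (· ∈ S) (funext ?_))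
  rintro (_ | i)
  · rfl
  · exact i.elim

theorem exists_sep [IsModel M] (P : M → Prop) [hP : Def M (fun p : Unit × M => P p.2)] (a : M) :
    ∃ b : M, ∀ x : M, x.1 ∈ b.1 ↔ x.1 ∈ a.1 ∧ P x := by
  obtain ⟨S, hS, h⟩ := hP
  obtain ⟨b, hb⟩ := IsModel.sep _ (hS.preimage_comp (fun _ : Option Empty => ())) a
  refine ⟨b, fun x => (hb x).trans (and_congr Iff.rfl ((h ((), x)).trans ?_).symm)⟩
  rw [Set.mem_preimage]
  refine iff_of_eq (congr_arg (· ∈ S) (funext ?_))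
  rintro (_ | i)
  · rfl
  · exact i.elim

/-! ### Natural numbers, elements and sequences as sorts -/

/-- The natural number `n` as a von Neumann ordinal. -/
noncomputable def natZ (n : ℕ) : ZFSet.{u} := (n : Ordinal.{u}).toZFSet

theorem mem_omegaSet {x : ZFSet.{u}} : x ∈ omegaSet ↔ ∃ n, natZ n = x := by
  rw [omegaSet, Ordinal.mem_toZFSet_iff]
  constructor
  · rintro ⟨a, ha, rfl⟩
    obtain ⟨n, rfl⟩ := Ordinal.lt_omega0.1 ha
    exact ⟨n, rfl⟩
  · rintro ⟨n, rfl⟩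
    exact ⟨n, Ordinal.natCast_lt_omega0 n, rfl⟩

theorem natZ_mem_natZ {m n : ℕ} : (natZ m : ZFSet.{u}) ∈ natZ n ↔ m < n := by
  simp [natZ]

theorem natZ_subset_natZ {m n : ℕ} : (natZ m : ZFSet.{u}) ⊆ natZ n ↔ m ≤ n := by
  simp [natZ]

theorem natZ_injective : Function.Injective (natZ : ℕ → ZFSet.{u}) := fun m n h => by
  exact_mod_cast Ordinal.toZFSet_injective h

noncomputable instance [IsModel M] : Srt M ℕ where
  enc n := ⟨natZ n, IsModel.trans _ IsModel.omega_mem _ (mem_omegaSet.2 ⟨n, rfl⟩)⟩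
  inj := fun m n h => natZ_injective (congr_arg Subtype.val h)
  range_def := Srt.range_def_of <|
    Def.congr (Q := fun p : Unit × M => p.2.1 ∈ (⟨omegaSet, IsModel.omega_mem⟩ : M).1)
      inferInstance fun p => by simp [mem_omegaSet, Subtype.ext_iff]

/-- The type of elements of the set `L ∈ M`; all of them are in `M`. -/
def Lam (L : M) : Type (u + 1) := {x : M // x.1 ∈ L.1}

instance (L : M) : Srt M (Lam L) where
  enc := Subtype.val
  inj := Subtype.val_injective
  range_def := Srt.range_def_of <|
    Def.congr (Q := fun p : Unit × M => p.2.1 ∈ L.1) inferInstance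
      fun p => ⟨by rintro ⟨y, hy⟩; rw [← hy]; exact y.2, fun h => ⟨⟨p.2, h⟩, rfl⟩⟩

instance Tm.val {L : M} {t : Γ → Lam L} [Tm M t] : Tm M (fun γ => (t γ).1) :=
  inferInstanceAs (Tm M (fun γ => (Srt.enc (t γ) : M)))

section nat
variable [IsModel M] {t s : Γ → ℕ} [Tm M t] [Tm M s]

instance Def.lt : Def M (fun γ => t γ < s γ) :=
  Def.congr (Q := fun γ => (Srt.enc (t γ) : M).1 ∈ (Srt.enc (s γ) : M).1) inferInstance
    fun _ => natZ_mem_natZ.symm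

instance Def.le : Def M (fun γ => t γ ≤ s γ) :=
  Def.congr (Q := fun γ => ¬ s γ < t γ) inferInstance fun _ => not_lt.symm

instance Tm.succ : Tm M (fun γ => t γ + 1) :=
  Tm.comp (Δ := Unit × ℕ) (F := fun p => p.2 + 1)
    ⟨Def.congr (M := M) (Q := fun p : (Unit × ℕ) × ℕ => p.1.2 < p.2 ∧
      ∀ i, i < p.2 → i ≤ p.1.2) inferInstance fun p => by
        constructor
        · intro h; rw [← h]; exact ⟨Nat.lt_succ_self _, fun i => Nat.lt_succ_iff.1⟩
        · rintro ⟨h1, h2⟩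
          have := h2 (p.2 - 1)
          omega⟩ (fun γ => ((), t γ))
end nat

/-- The Kuratowski pair, as an operation of `M`. -/
noncomputable def pr [IsModel M] (x y : M) : M :=
  ⟨ZFSet.pair x.1 y.1, by
    rw [ZFSet.pair, ← ZFSet.pair_eq_singleton]
    exact IsModel.pair_mem _ (IsModel.pair_mem _ x.2 _ x.2) _ (IsModel.pair_mem _ x.2 _ y.2)⟩

theorem pr_val [IsModel M] (x y : M) :
    (pr x y).1 = {({x.1, x.1} : ZFSet.{u}), ({x.1, y.1} : ZFSet.{u})} := by
  rw [ZFSet.pair_eq_singleton]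
  rfl

/-- The unordered pair in the sense of `M` is the actual one. -/
theorem isPair_iff [IsModel M] {x y z : M} :
    (∀ w : M, w.1 ∈ z.1 ↔ w = x ∨ w = y) ↔ z.1 = {x.1, y.1} := by
  constructor
  · intro h
    refine ext_of_trans IsModel.trans z.2 (IsModel.pair_mem _ x.2 _ y.2) fun w hw => ?_
    rw [ZFSet.mem_pair]
    simpa [Subtype.ext_iff] using h ⟨w, hw⟩
  · intro h w
    rw [h, ZFSet.mem_pair, Subtype.ext_iff, Subtype.ext_iff]

instance Tm.pr [IsModel M] {t s : Γ → M} [Tm M t] [Tm M s] : Tm M (fun γ => pr (t γ) (s γ)) :=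
  Tm.comp (Δ := (Unit × M) × M) (F := fun p => SetModel.pr p.1.2 p.2)
    ⟨Def.congr (M := M) (Q := fun p : ((Unit × M) × M) × M => ∃ a b : M,
      (∀ w : M, w.1 ∈ p.2.1 ↔ w = a ∨ w = b) ∧
      (∀ w : M, w.1 ∈ a.1 ↔ w = p.1.1.2 ∨ w = p.1.1.2) ∧
      (∀ w : M, w.1 ∈ b.1 ↔ w = p.1.1.2 ∨ w = p.1.2)) inferInstance
      fun p => by
        simp only [isPair_iff]
        rw [Subtype.ext_iff, pr_val]
        constructor
        · intro h
          exact ⟨⟨_, IsModel.pair_mem _ p.1.1.2.2 _ p.1.1.2.2⟩,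
            ⟨_, IsModel.pair_mem _ p.1.1.2.2 _ p.1.2.2⟩, h.symm, rfl, rfl⟩
        · rintro ⟨a, b, h, ha, hb⟩
          rw [h, ha, hb]⟩ (fun γ => (((), t γ), s γ))

/-- The functions `ω → L` that belong to `M`. -/
def Sq (L : M) : Type (u + 1) := {s : M // ZFSet.IsFunc omegaSet L.1 s.1}

variable [IsModel M] {L : M}

/-- A form of `IsFunc` in which all quantifiers range over sorts. -/
theorem isFunc_iff {s : M} : ZFSet.IsFunc omegaSet L.1 s.1 ↔
    (∀ p : M, p.1 ∈ s.1 → ∃ (n : ℕ) (x : Lam L), pr (Srt.enc n) x.1 = p) ∧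
      ∀ n : ℕ, ∃ x : Lam L, (pr (Srt.enc n) x.1).1 ∈ s.1 ∧
        ∀ y : Lam L, (pr (Srt.enc n) y.1).1 ∈ s.1 → y = x := by
  constructor
  · rintro ⟨h1, h2⟩
    have h3 : ∀ p : M, p.1 ∈ s.1 → ∃ (n : ℕ) (x : Lam L), pr (Srt.enc n) x.1 = p := by
      intro p hp
      obtain ⟨a, ha, b, hb, hab⟩ := ZFSet.mem_prod.1 (h1 hp)
      obtain ⟨n, rfl⟩ := mem_omegaSet.1 ha
      exact ⟨n, ⟨⟨b, IsModel.trans _ L.2 _ hb⟩, hb⟩, Subtype.ext hab.symm⟩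
    refine ⟨h3, fun n => ?_⟩
    obtain ⟨x, hx, hxu⟩ := h2 (natZ n) (mem_omegaSet.2 ⟨n, rfl⟩)
    have hxL := (ZFSet.pair_mem_prod.1 (h1 hx)).2
    exact ⟨⟨⟨x, IsModel.trans _ L.2 _ hxL⟩, hxL⟩, hx, fun y hy =>
      Subtype.ext (Subtype.ext (hxu _ hy))⟩
  · rintro ⟨h1, h2⟩
    have h3 : s.1 ⊆ ZFSet.prod omegaSet L.1 := by
      intro p hp
      obtain ⟨n, x, hx⟩ := h1 ⟨p, IsModel.trans _ s.2 _ hp⟩ hp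
      have hx : ZFSet.pair (natZ n) x.1.1 = p := congr_arg Subtype.val hx
      exact hx ▸ ZFSet.pair_mem_prod.2 ⟨mem_omegaSet.2 ⟨n, rfl⟩, x.2⟩
    refine ⟨h3, fun z hz => ?_⟩
    obtain ⟨n, rfl⟩ := mem_omegaSet.1 hz
    obtain ⟨x, hx, hxu⟩ := h2 n
    refine ⟨x.1.1, hx, fun y hy => ?_⟩
    have hyL := (ZFSet.pair_mem_prod.1 (h3 hy)).2
    exact congr_arg (fun z : Lam L => z.1.1) (hxu ⟨⟨y, IsModel.trans _ L.2 _ hyL⟩, hyL⟩ hy)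

instance : Srt M (Sq L) where
  enc := Subtype.val
  inj := Subtype.val_injective
  range_def := Srt.range_def_of <|
    Def.congr (Q := fun q : Unit × M =>
      (∀ p : M, p.1 ∈ q.2.1 → ∃ (n : ℕ) (x : Lam L), pr (Srt.enc n) x.1 = p) ∧
      ∀ n : ℕ, ∃ x : Lam L, (pr (Srt.enc n) x.1).1 ∈ q.2.1 ∧
        ∀ y : Lam L, (pr (Srt.enc n) y.1).1 ∈ q.2.1 → y = x) inferInstance
      fun q => by
        rw [← isFunc_iff]
        exact ⟨by rintro ⟨y, hy⟩; rw [← hy]; exact y.2, fun h => ⟨⟨q.2, h⟩, rfl⟩⟩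

/-- The value of a sequence at a natural number. -/
noncomputable def Sq.app (s : Sq L) (n : ℕ) : Lam L := ((isFunc_iff.1 s.2).2 n).choose

theorem Sq.app_eq_iff {s : Sq L} {n : ℕ} {x : Lam L} :
    s.app n = x ↔ (SetModel.pr (Srt.enc n) x.1).1 ∈ s.1.1 := by
  have := ((isFunc_iff.1 s.2).2 n).choose_spec
  constructor
  · rintro rfl; exact this.1
  · exact fun h => (this.2 _ h).symm

instance Tm.app {s : Γ → Sq L} {n : Γ → ℕ} [Tm M s] [Tm M n] :
    Tm M (fun γ => (s γ).app (n γ)) :=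
  Tm.comp (Δ := (Unit × Sq L) × ℕ) (F := fun p => p.1.2.app p.2)
    ⟨Def.congr (M := M) (Q := fun p : ((Unit × Sq L) × ℕ) × Lam L =>
      (SetModel.pr (Srt.enc p.1.2) p.2.1).1 ∈ (Srt.enc p.1.1.2 : M).1) inferInstance
      fun _ => Sq.app_eq_iff⟩ (fun γ => (((), s γ), n γ))

/-- Definable functions `ℕ → L` are sequences of `M`. -/
theorem exists_sq (hL : omegaSet ⊆ L.1) (h : ℕ → Lam L) [hh : Tm M (fun p : Unit × ℕ => h p.2)] :
    ∃ s : Sq L, s.app = h := by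
  obtain ⟨P, hP, hP'⟩ := IsModel.pow _ L.2
  obtain ⟨Q, hQ, hQ'⟩ := IsModel.pow _ hP
  have : Tm M (fun q : (Unit × M) × ℕ => h q.2) :=
    Tm.comp (F := fun p : Unit × ℕ => h p.2) hh (fun q : (Unit × M) × ℕ => ((), q.2))
  have : Def M (fun q : ((Unit × M) × ℕ) × Lam L => h q.1.2 = q.2) := this.out
  obtain ⟨s, hs⟩ := exists_sep
    (fun p : M => ∃ (n : ℕ) (x : Lam L), h n = x ∧ pr (Srt.enc n) x.1 = p) ⟨Q, hQ⟩
  have key : ∀ (n : ℕ) (x : Lam L), (pr (Srt.enc n) x.1).1 ∈ s.1 ↔ h n = x := by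
    intro n x
    rw [hs]
    constructor
    · rintro ⟨-, m, y, hm, hp⟩
      obtain ⟨h1, h2⟩ := ZFSet.pair_inj.1 (congr_arg Subtype.val hp)
      rw [← natZ_injective h1, hm]
      exact Subtype.ext (Subtype.ext h2)
    · intro hx
      refine ⟨hQ' _ (pr _ _).2 ?_, n, x, hx, rfl⟩
      have hn : natZ n ∈ L.1 := hL (mem_omegaSet.2 ⟨n, rfl⟩)
      have hnM : natZ n ∈ M := IsModel.trans _ L.2 _ hn
      have hin : ∀ y ∈ M, y ∈ L.1 → ({natZ n, y} : ZFSet.{u}) ∈ P := fun y hyM hy =>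
        hP' _ (IsModel.pair_mem _ hnM _ hyM) fun z hz => by
          rcases ZFSet.mem_pair.1 hz with rfl | rfl <;> assumption
      intro z hz
      change z ∈ ZFSet.pair (natZ n) x.1.1 at hz
      rw [ZFSet.pair, ← ZFSet.pair_eq_singleton] at hz
      rcases ZFSet.mem_pair.1 hz with rfl | rfl
      · exact hin _ hnM hn
      · exact hin _ x.1.2 x.2
  refine ⟨⟨s, isFunc_iff.2 ⟨fun p hp => ?_, fun n => ⟨h n, (key _ _).2 rfl, fun y hy =>
    ((key _ _).1 hy).symm⟩⟩⟩, ?_⟩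
  · obtain ⟨-, n, x, -, hx⟩ := (hs p).1 hp
    exact ⟨n, x, hx⟩
  · funext n
    exact Sq.app_eq_iff.2 ((key _ _).2 rfl)

end Sorts

/-! ### Dominated subsets and compactness -/

section Compactness
variable {M : Set ZFSet.{u}} {Γ : Type w} [Ctx M Γ] [IsModel M] {L : M}

/-- The trace on `L` of a set `D ∈ M`. -/
def tr (D : M) : Set (Lam L) := {x | x.1.1 ∈ D.1}

instance Def.mem_tr {t : Γ → Lam L} {D : Γ → M} [Tm M t] [Tm M D] :
    Def M (fun γ => t γ ∈ tr (D γ)) :=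
  inferInstanceAs (Def M (fun γ => (t γ).1.1 ∈ (D γ).1))

/-- Definable subsets of `L` belong to `M`. -/
theorem exists_tr (P : Lam L → Prop) [hP : Def M (fun p : Unit × Lam L => P p.2)] :
    ∃ b : M, b.1 ⊆ L.1 ∧ ∀ x : Lam L, x ∈ tr b ↔ P x := by
  have : Def M (fun p : (Unit × M) × Lam L => P p.2) :=
    Def.comp hP (fun p : (Unit × M) × Lam L => ((), p.2))
  obtain ⟨b, hb⟩ := exists_sep (fun y : M => ∃ x : Lam L, x.1 = y ∧ P x) L
  refine ⟨b, fun y hy => ((hb ⟨y, IsModel.trans _ b.2 _ hy⟩).1 hy).1, fun x => ?_⟩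
  refine (hb x.1).trans ⟨?_, fun h => ⟨x.2, x, rfl, h⟩⟩
  rintro ⟨-, y, hy, h⟩
  rwa [← Subtype.ext hy]

theorem exists_tr_finite {F : Set (Lam L)} (hF : F.Finite) : ∃ b : M, tr b = F := by
  suffices Def M (fun p : Unit × Lam L => p.2 ∈ F) by
    obtain ⟨b, -, hb⟩ := exists_tr (fun x => x ∈ F)
    exact ⟨b, Set.ext hb⟩
  induction F, hF using Set.Finite.induction_on with
  | empty => exact inferInstanceAs (Def M fun _ => False)
  | insert _ _ ih => exact inferInstanceAs (Def M fun p : Unit × Lam L => p.2 = _ ∨ p.2 ∈ _)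

theorem exists_sq_update (hL : omegaSet ⊆ L.1) (s : Sq L) (k : ℕ) (ξ : Lam L) :
    ∃ s' : Sq L, s'.app = Function.update s.app k ξ := by
  refine @exists_sq _ _ _ hL _ ⟨Def.congr (Q := fun p : (Unit × ℕ) × Lam L =>
    (p.1.2 = k ∧ ξ = p.2) ∨ (¬ p.1.2 = k ∧ s.app p.1.2 = p.2)) inferInstance fun p => ?_⟩
  rcases eq_or_ne p.1.2 k with h | h <;> simp [h]

/-- Every finite subset of `L` is contained in the range of an initial segment of a sequence of
`M`. This allows `M` to quantify over finite sets. -/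
theorem exists_cover (hL : omegaSet ⊆ L.1) (F : Finset (Lam L)) :
    ∃ (t : Sq L) (l : ℕ), ∀ x ∈ F, ∃ m < l, t.app m = x := by
  classical
  induction F using Finset.induction with
  | empty =>
    have h0 : natZ 0 ∈ L.1 := hL (mem_omegaSet.2 ⟨0, rfl⟩)
    obtain ⟨s, -⟩ := exists_sq hL
      (fun _ => (⟨⟨_, IsModel.trans _ L.2 _ h0⟩, h0⟩ : Lam L)) (hh := Tm.const _)
    exact ⟨s, 0, by simp⟩
  | insert a F _ ih =>
    obtain ⟨t, l, h⟩ := ih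
    obtain ⟨t', h'⟩ := exists_sq_update hL t l a
    refine ⟨t', l + 1, fun x hx => ?_⟩
    rcases Finset.mem_insert.1 hx with rfl | hx
    · exact ⟨l, by omega, by simp [h']⟩
    · obtain ⟨m, hm, rfl⟩ := h x hx
      exact ⟨m, by omega, by simp [h', hm.ne]⟩

/-- A function from the sequences of `M` to `ℕ` that is definable over `M`. -/
structure Bound (L : M) where
  val : Sq L → ℕ
  tm : Tm M (fun p : Unit × Sq L => val p.2)

instance Tm.bound {G : Bound L} {s : Γ → Sq L} [Tm M s] : Tm M (fun γ => G.val (s γ)) :=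
  Tm.comp (Δ := Unit × Sq L) (F := fun p => G.val p.2) G.tm (fun γ => ((), s γ))

/-- `j` is the least number such that exactly one of `β 0`, `β j` is in `B`. -/
def FirstChange (β : ℕ → Lam L) (B : Set (Lam L)) (j : ℕ) : Prop :=
  (∀ i, i < j → (β i ∈ B ↔ β 0 ∈ B)) ∧ ¬ (β j ∈ B ↔ β 0 ∈ B)

/-- The first change of membership in `B` along a sequence `β ∈ M`, if there is one, occurs at most
at `G β`. Here `B` need not be in `M`. -/
def Good (G : Bound L) (B : Set (Lam L)) : Prop :=
  ∀ (β : Sq L) (j : ℕ), G.val β < j → ¬ FirstChange β.app B j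

/-- `B` and `D` agree on `s 0, …, s (k - 1)`. The pair `(s, D)` with the length `k` serves as a
finite condition on `B`. -/
def Agree (s : ℕ → Lam L) (k : ℕ) (B D : Set (Lam L)) : Prop := ∀ i, i < k → (s i ∈ B ↔ s i ∈ D)

/-- The finite part of `Good` that concerns only the elements `t 0, …, t (l - 1)`. -/
def GoodOn (G : Bound L) (t : ℕ → Lam L) (l : ℕ) (B : Set (Lam L)) : Prop :=
  ∀ (β : Sq L) (j : ℕ), G.val β < j → (∀ i, i ≤ j → ∃ m, m < l ∧ t m = β.app i) →
    ¬ FirstChange β.app B j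

instance Def.agree {s : Γ → Sq L} {k : Γ → ℕ} {D E : Γ → M} [Tm M s] [Tm M k] [Tm M D] [Tm M E] :
    Def M (fun γ => Agree (s γ).app (k γ) (tr (D γ)) (tr (E γ))) :=
  Def.comp (P := fun p : (((Unit × Sq L) × ℕ) × M) × M =>
    ∀ i, i < p.1.1.2 → (p.1.1.1.2.app i ∈ tr p.1.2 ↔ p.1.1.1.2.app i ∈ tr p.2)) inferInstance
    (fun γ => (((((), s γ), k γ), D γ), E γ))

instance Def.firstChange {s : Γ → Sq L} {j : Γ → ℕ} {D : Γ → M} [Tm M s] [Tm M j] [Tm M D] :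
    Def M (fun γ => FirstChange (s γ).app (tr (D γ)) (j γ)) :=
  Def.comp (P := fun p : ((Unit × Sq L) × M) × ℕ =>
    (∀ i, i < p.2 → (p.1.1.2.app i ∈ tr p.1.2 ↔ p.1.1.2.app 0 ∈ tr p.1.2)) ∧
      ¬ (p.1.1.2.app p.2 ∈ tr p.1.2 ↔ p.1.1.2.app 0 ∈ tr p.1.2)) inferInstance
    (fun γ => ((((), s γ), D γ), j γ))

instance Def.goodOn {G : Bound L} {s : Γ → Sq L} {k : Γ → ℕ} {D : Γ → M} [Tm M s] [Tm M k]
    [Tm M D] : Def M (fun γ => GoodOn G (s γ).app (k γ) (tr (D γ))) :=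
  Def.comp (P := fun p : ((Unit × Sq L) × ℕ) × M =>
    ∀ (β : Sq L) (j : ℕ), G.val β < j → (∀ i, i ≤ j → ∃ m, m < p.1.2 ∧ p.1.1.2.app m = β.app i) →
    ¬ FirstChange β.app (tr p.2) j) inferInstance
    (fun γ => ((((), s γ), k γ), D γ))

omit [IsModel M] in
theorem FirstChange.congr {β : ℕ → Lam L} {B D : Set (Lam L)} {j : ℕ} (h : FirstChange β B j)
    (hBD : ∀ i ≤ j, β i ∈ B ↔ β i ∈ D) : FirstChange β D j :=
  ⟨fun i hi => by rw [← hBD i hi.le, ← hBD 0 (Nat.zero_le j)]; exact h.1 i hi,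
    by rw [← hBD j le_rfl, ← hBD 0 (Nat.zero_le j)]; exact h.2⟩

/-- Compactness of `2^L`: finitely many membership facts, given as pairs of an element and a truth
value, are realised by a good set if for every finite subset of `L` they are realised by a set in
`M` that is good on this subset. -/
theorem exists_good_iff (hL : omegaSet ⊆ L.1) (G : Bound L) {F : Set (Lam L × Prop)}
    (hF : F.Finite) : (∃ B, Good G B ∧ ∀ p ∈ F, p.1 ∈ B ↔ p.2) ↔
      ∀ (t : Sq L) (l : ℕ), ∃ E : M, (∀ p ∈ F, p.1 ∈ tr E ↔ p.2) ∧ GoodOn G t.app l (tr E) := by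
  classical
  constructor
  · rintro ⟨B, hB, hBD⟩ t l
    obtain ⟨E, hE⟩ := exists_tr_finite (F := B ∩ (Prod.fst '' F ∪ t.app '' Set.Iio l))
      (((hF.image _).union ((Set.finite_Iio l).image _)).inter_of_right _)
    refine ⟨E, fun x hx => ?_, fun β j hj hβ h =>
      hB β j hj (h.congr fun i hi => ?_)⟩
    · rw [hE, ← hBD x hx]
      exact ⟨fun h => h.1, fun h => ⟨h, Or.inl ⟨x, hx, rfl⟩⟩⟩
    obtain ⟨m, hm, h⟩ := hβ i hi
    rw [hE]
    exact ⟨fun h => h.1, fun h' => ⟨h', Or.inr ⟨m, hm, h⟩⟩⟩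
  · intro h
    choose t l htl using fun F : Finset (Lam L) => exists_cover hL F
    choose E hE hE' using fun F => h (t F) (l F)
    let U : Ultrafilter (Finset (Lam L)) := Ultrafilter.of Filter.atTop
    have hU : (U : Filter (Finset (Lam L))) ≤ Filter.atTop := Ultrafilter.of_le _
    let B : Set (Lam L) := {x | ∀ᶠ F in (U : Filter (Finset (Lam L))), x ∈ tr (E F)}
    have hB : ∀ x, ∀ᶠ F in (U : Filter (Finset (Lam L))), (x ∈ tr (E F) ↔ x ∈ B) := by
      intro x
      by_cases hx : x ∈ B
      · filter_upwards [show ∀ᶠ F in (U : Filter _), x ∈ tr (E F) from hx] with F h'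
        simp [h', hx]
      · filter_upwards [Ultrafilter.eventually_not.2 hx] with F h'
        simp [h', hx]
    refine ⟨B, fun β j hj hβ => ?_, fun x hx => ?_⟩
    · have h1 : ∀ᶠ F in (U : Filter (Finset (Lam L))), ∀ i ∈ Set.Iic j,
          (β.app i ∈ tr (E F) ↔ β.app i ∈ B) :=
        (Filter.eventually_all_finite (Set.finite_Iic j)).2 fun i _ => hB _
      have h2 : ∀ᶠ F in (U : Filter (Finset (Lam L))), (Finset.range (j + 1)).image β.app ≤ F :=
        hU (Filter.eventually_ge_atTop _)
      obtain ⟨F', h1, h2⟩ := (h1.and h2).exists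
      refine hE' F' β j hj (fun i hi => ?_) (hβ.congr fun i hi => (h1 i hi).symm)
      exact htl F' _ (h2 (Finset.mem_image_of_mem _ (Finset.mem_range.2 (by omega))))
    · obtain ⟨F', h⟩ := (hB x.1).exists
      rw [← h]
      exact hE F' x hx

/-- Some good set satisfies the condition `(s, k, D)` and contains `ξ` or not as `b` says. -/
def Side (G : Bound L) (s : ℕ → Lam L) (k : ℕ) (D : Set (Lam L)) (ξ : Lam L) (b : Prop) : Prop :=
  ∃ B, Good G B ∧ Agree s k B D ∧ (ξ ∈ B ↔ b)

/-- The right-hand side quantifies over `M` only, which makes `Side` definable. -/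
theorem side_iff (hL : omegaSet ⊆ L.1) (G : Bound L) (s : ℕ → Lam L) (k : ℕ) (D : Set (Lam L))
    (ξ : Lam L) (b : Prop) : Side G s k D ξ b ↔ ∀ (t : Sq L) (l : ℕ), ∃ E : M,
      (Agree s k (tr E) D ∧ (ξ ∈ tr E ↔ b)) ∧ GoodOn G t.app l (tr E) := by
  have h := exists_good_iff hL G (F := insert (ξ, b) ((fun i => (s i, s i ∈ D)) '' Set.Iio k))
    (((Set.finite_Iio k).image _).insert _)
  simp only [Set.mem_insert_iff, Set.mem_image, forall_eq_or_imp, forall_exists_index, and_imp,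
    forall_apply_eq_imp_iff₂, Set.mem_Iio] at h
  simp only [Side, Agree]
  simpa only [and_comm, and_left_comm] using h

/-- Good sets satisfying the condition `(s, k, D)` may contain `ξ` and may omit `ξ`. -/
def Split (G : Bound L) (s : ℕ → Lam L) (k : ℕ) (D : Set (Lam L)) (ξ : Lam L) : Prop :=
  Side G s k D ξ True ∧ Side G s k D ξ False

/-- Finitely many membership facts determine a good set among those that satisfy the condition
`(s, k, D)`. Inclusion in place of equality suffices, as the hypotheses are symmetric in `B`
and `B'`. -/
def FinDet (G : Bound L) (s : ℕ → Lam L) (k : ℕ) (D : Set (Lam L)) : Prop :=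
  ∃ F : Finset (Lam L), ∀ B B', Good G B → Good G B' → Agree s k B D → Agree s k B' D →
    (∀ x ∈ F, x ∈ B ↔ x ∈ B') → B ⊆ B'

/-- The right-hand side quantifies over `M` only, which makes `FinDet` definable. -/
theorem finDet_iff (hL : omegaSet ⊆ L.1) (G : Bound L) (s : ℕ → Lam L) (k : ℕ) (D : Set (Lam L)) :
    FinDet G s k D ↔ ∃ (t : Sq L) (l : ℕ), (∀ i, i < k → ∃ m, m < l ∧ t.app m = s i) ∧
      ∀ (ξ : Lam L) (E : M), Agree s k (tr E) D → ¬ Split G t.app l (tr E) ξ := by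
  classical
  constructor
  · rintro ⟨F, hF⟩
    obtain ⟨t, l, htl⟩ := exists_cover hL (F ∪ (Finset.range k).image s)
    have hs : ∀ i, i < k → ∃ m, m < l ∧ t.app m = s i := fun i hi =>
      htl _ (Finset.mem_union_right _ (Finset.mem_image_of_mem _ (Finset.mem_range.2 hi)))
    refine ⟨t, l, hs, ?_⟩
    rintro ξ E hE ⟨⟨B, hB, hBE, hξ⟩, ⟨B', hB', hBE', hξ'⟩⟩
    have hD : ∀ B : Set (Lam L), Agree t.app l B (tr E) → Agree s k B D := by
      intro B hB i hi
      rw [← hE i hi]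
      obtain ⟨m, hm, h⟩ := hs i hi
      rw [← h]
      exact hB m hm
    refine hξ'.1 (hF B B' hB hB' (hD B hBE) (hD B' hBE') (fun x hx => ?_) (hξ.2 trivial))
    obtain ⟨m, hm, rfl⟩ := htl x (Finset.mem_union_left _ hx)
    rw [hBE m hm, hBE' m hm]
  · rintro ⟨t, l, hs, h⟩
    refine ⟨(Finset.range l).image t.app, fun B B' hB hB' hBD hBD' hBB ξ hξ => ?_⟩
    by_contra hξ'
    obtain ⟨E, hE⟩ := exists_tr_finite (F := B ∩ t.app '' Set.Iio l)
      (((Set.finite_Iio l).image _).inter_of_right _)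
    have hBE : Agree t.app l B (tr E) := fun m hm => by
      rw [hE]; exact ⟨fun h => ⟨h, m, hm, rfl⟩, fun h => h.1⟩
    have hBE' : Agree t.app l B' (tr E) := fun m hm => by
      rw [← hBE m hm]
      exact (hBB _ (Finset.mem_image_of_mem _ (Finset.mem_range.2 hm))).symm
    refine h ξ E (fun i hi => ?_) ⟨⟨B, hB, hBE, by simpa⟩, ⟨B', hB', hBE', by simpa⟩⟩
    obtain ⟨m, hm, hi'⟩ := hs i hi
    rw [← hBD i hi, ← hi']
    exact (hBE m hm).symm

section
variable [hL : Fact (omegaSet ⊆ L.1)] {G : Bound L} {s : Γ → Sq L} {k : Γ → ℕ} {D : Γ → M}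
  {ξ : Γ → Lam L} [Tm M s] [Tm M k] [Tm M D] [Tm M ξ]

instance Def.side {b : Prop} : Def M (fun γ => Side G (s γ).app (k γ) (tr (D γ)) (ξ γ) b) :=
  Def.comp (P := fun p : (((Unit × Sq L) × ℕ) × M) × Lam L =>
    Side G p.1.1.1.2.app p.1.1.2 (tr p.1.2) p.2 b)
    (Def.congr inferInstance fun _ => side_iff hL.out _ _ _ _ _ _)
    (fun γ => (((((), s γ), k γ), D γ), ξ γ))

instance Def.split : Def M (fun γ => Split G (s γ).app (k γ) (tr (D γ)) (ξ γ)) :=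
  inferInstanceAs (Def M (fun _ => _ ∧ _))

instance Def.finDet : Def M (fun γ => FinDet G (s γ).app (k γ) (tr (D γ))) :=
  Def.comp (P := fun p : ((Unit × Sq L) × ℕ) × M => FinDet G p.1.1.2.app p.1.2 (tr p.2))
    (Def.congr inferInstance fun _ => finDet_iff hL.out _ _ _ _)
    (fun γ => ((((), s γ), k γ), D γ))
end

/-- The condition `(s, n, D)` is obtained by `n` steps of the splitting recursion: at step `k` the
least splitting element `s k` is added, and it is put into `D` if and only if the condition
prolonged in this way does not become finitely determined. -/
def Run (G : Bound L) (s : ℕ → Lam L) (D : Set (Lam L)) (n : ℕ) : Prop :=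
  ∀ k, k < n → Split G s k D (s k) ∧ (∀ η : Lam L, η.1.1 ∈ (s k).1.1 → ¬ Split G s k D η) ∧
    (s k ∈ D ↔ ∃ D' : M, Agree s k (tr D') D ∧ s k ∈ tr D' ∧ ¬ FinDet G s (k + 1) (tr D'))

instance Def.run [hL : Fact (omegaSet ⊆ L.1)] {G : Bound L} {s : Γ → Sq L} {n : Γ → ℕ} {D : Γ → M}
    [Tm M s] [Tm M n] [Tm M D] : Def M (fun γ => Run G (s γ).app (tr (D γ)) (n γ)) :=
  Def.comp (P := fun p : ((Unit × Sq L) × M) × ℕ => Run G p.1.1.2.app (tr p.1.2) p.2)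
    (inferInstanceAs (Def M fun p : ((Unit × Sq L) × M) × ℕ =>
      ∀ k, k < p.2 → Split G p.1.1.2.app k (tr p.1.2) (p.1.1.2.app k) ∧
        (∀ η : Lam L, η.1.1 ∈ (p.1.1.2.app k).1.1 → ¬ Split G p.1.1.2.app k (tr p.1.2) η) ∧
        (p.1.1.2.app k ∈ tr p.1.2 ↔ ∃ D' : M, Agree p.1.1.2.app k (tr D') (tr p.1.2) ∧
          p.1.1.2.app k ∈ tr D' ∧ ¬ FinDet G p.1.1.2.app (k + 1) (tr D'))))
    (fun γ => ((((), s γ), D γ), n γ))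

end Compactness

/-! ### Splitting runs -/

section Runs
variable {M : Set ZFSet.{u}} [IsModel M] {L : M} {G : Bound L} {s s' : ℕ → Lam L}
  {D D' : Set (Lam L)} {k n : ℕ}

/-- `(s, k, D)` and `(s', k, D')` are the same finite condition. -/
def Same (s s' : ℕ → Lam L) (D D' : Set (Lam L)) (k : ℕ) : Prop :=
  ∀ i, i < k → s i = s' i ∧ (s i ∈ D ↔ s' i ∈ D')

omit [IsModel M] in
theorem Same.agree_iff (h : Same s s' D D' k) (B : Set (Lam L)) :
    Agree s k B D ↔ Agree s' k B D' :=
  forall₂_congr fun i hi => by rw [(h i hi).2, (h i hi).1]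

theorem Same.split_iff (h : Same s s' D D' k) (ξ : Lam L) :
    Split G s k D ξ ↔ Split G s' k D' ξ := by
  simp only [Split, Side, h.agree_iff]

theorem Same.finDet_iff (h : Same s s' D D' k) : FinDet G s k D ↔ FinDet G s' k D' := by
  simp only [FinDet, h.agree_iff]

theorem Same.run (h : Same s s' D D' n) (hr : Run G s D n) : Run G s' D' n := by
  intro k hk
  obtain ⟨h1, h2, h3⟩ := hr k hk
  have hS : Same s s' D D' k := fun i hi => h i (hi.trans hk)
  have hk' := h k hk
  refine ⟨?_, fun η hη => ?_, ?_⟩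
  · rw [← hk'.1, ← hS.split_iff]; exact h1
  · rw [← hk'.1] at hη; rw [← hS.split_iff]; exact h2 η hη
  · rw [← hk'.2, h3]
    refine exists_congr fun E => ?_
    have hE : Same s s' (tr E) (tr E) (k + 1) := fun i hi => by
      have := (h i (by omega)).1
      exact ⟨this, by rw [this]⟩
    have hE' : Agree s k (tr E) D ↔ Agree s' k (tr E) D' := hS.agree_iff _
    rw [hE.finDet_iff, hE', hk'.1]

theorem exists_min_split (h : ¬ FinDet G s k D) :
    ∃ ξ : Lam L, Split G s k D ξ ∧ ∀ η : Lam L, η.1.1 ∈ ξ.1.1 → ¬ Split G s k D η := by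
  have hne : ∃ ξ, Split G s k D ξ := by
    by_contra! hs
    refine h ⟨∅, fun B B' hB hB' hBD hBD' _ ξ hξ => ?_⟩
    by_contra hξ'
    exact hs ξ ⟨⟨B, hB, hBD, by simpa⟩, ⟨B', hB', hBD', by simpa⟩⟩
  have hwf : WellFounded fun x y : Lam L => x.1.1 ∈ y.1.1 :=
    InvImage.wf (fun x : Lam L => x.1.1) ZFSet.mem_wf
  obtain ⟨ξ, hξ, hmin⟩ := hwf.has_min {ξ | Split G s k D ξ} hne
  exact ⟨ξ, hξ, fun η hη hs => hmin η hs hη⟩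

theorem Split.ne {ξ : Lam L} (h : Split G s k D ξ) {i : ℕ} (hi : i < k) : s i ≠ ξ := by
  rintro rfl
  obtain ⟨⟨B, -, hB, h1⟩, ⟨B', -, hB', h2⟩⟩ := h
  rw [hB i hi] at h1
  rw [hB' i hi] at h2
  tauto

/-- A condition that is not finitely determined can be prolonged at its least splitting element: if
both prolongations were finitely determined, so would be the condition. -/
theorem exists_run_succ (hL : omegaSet ⊆ L.1) {s : Sq L} {D : M} (hr : Run G s.app (tr D) n)
    (h : ¬ FinDet G s.app n (tr D)) : ∃ (s' : Sq L) (D' : M), Run G s'.app (tr D') (n + 1) ∧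
      ¬ FinDet G s'.app (n + 1) (tr D') := by
  classical
  obtain ⟨ξ, hξ, hmin⟩ := exists_min_split h
  obtain ⟨s', hs'⟩ := exists_sq_update hL s n ξ
  have hsn : s'.app n = ξ := by simp [hs']
  have hsi : ∀ i < n, s'.app i = s.app i := fun i hi => by simp [hs', hi.ne]
  -- A run is prolonged by any `E` that agrees with `D` so far and decides `ξ` by the rule.
  have key : ∀ E : M, Agree s.app n (tr E) (tr D) → (ξ ∈ tr E ↔ ∃ D' : M,
      Agree s'.app n (tr D') (tr E) ∧ ξ ∈ tr D' ∧ ¬ FinDet G s'.app (n + 1) (tr D')) →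
      Run G s'.app (tr E) (n + 1) := by
    intro E hE hξE
    have hS : Same s.app s'.app (tr D) (tr E) n := fun i hi =>
      ⟨(hsi i hi).symm, by rw [hsi i hi]; exact (hE i hi).symm⟩
    intro k hk
    rcases (Nat.lt_succ_iff.1 hk).lt_or_eq with hk | rfl
    · exact hS.run hr k hk
    · rw [hsn]
      exact ⟨(hS.split_iff _).1 hξ, fun η hη => mt (hS.split_iff _).2 (hmin η hη), hξE⟩
  by_cases hp : ∃ D' : M, Agree s'.app n (tr D') (tr D) ∧ ξ ∈ tr D' ∧
      ¬ FinDet G s'.app (n + 1) (tr D')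
  · obtain ⟨E, hE, hξE, hf⟩ := hp
    refine ⟨s', E, key E (fun i hi => ?_) ?_, hf⟩
    · rw [← hsi i hi]; exact hE i hi
    · exact iff_of_true hξE ⟨E, fun _ _ => Iff.rfl, hξE, hf⟩
  · obtain ⟨E₁, -, hE₁⟩ := exists_tr (fun x : Lam L => x ∈ tr D ∨ x = ξ)
    obtain ⟨E₀, -, hE₀⟩ := exists_tr (fun x : Lam L => x ∈ tr D ∧ ¬ x = ξ)
    have hA₁ : Agree s.app n (tr E₁) (tr D) := fun i hi => by simp [hE₁, hξ.ne hi]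
    have hA₀ : Agree s.app n (tr E₀) (tr D) := fun i hi => by simp [hE₀, hξ.ne hi]
    have hf₁ : FinDet G s'.app (n + 1) (tr E₁) := by
      by_contra hf
      refine hp ⟨E₁, fun i hi => ?_, by simp [hE₁], hf⟩
      rw [hsi i hi]; exact hA₁ i hi
    refine ⟨s', E₀, key E₀ hA₀ (iff_of_false (by simp [hE₀]) ?_), fun hf₀ => h ?_⟩
    · rintro ⟨E, hE, hξE, hf⟩
      refine hp ⟨E, fun i hi => ?_, hξE, hf⟩
      rw [hE i hi, hsi i hi]; exact hA₀ i hi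
    · obtain ⟨F₁, hF₁⟩ := hf₁
      obtain ⟨F₀, hF₀⟩ := hf₀
      refine ⟨insert ξ (F₀ ∪ F₁), fun B B' hB hB' hBD hBD' hBB => ?_⟩
      have hext : ∀ (E : M) (B : Set (Lam L)), Agree s.app n (tr E) (tr D) →
          Agree s.app n B (tr D) → (ξ ∈ B ↔ ξ ∈ tr E) → Agree s'.app (n + 1) B (tr E) := by
        intro E B hE hB hξE i hi
        rcases (Nat.lt_succ_iff.1 hi).lt_or_eq with hi | rfl
        · rw [hsi i hi, hB i hi, hE i hi]
        · rw [hsn]; exact hξE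
      have hξB : ξ ∈ B ↔ ξ ∈ B' := hBB ξ (by simp)
      by_cases hx : ξ ∈ B
      · exact hF₁ B B' hB hB' (hext _ _ hA₁ hBD (by simp [hE₁, hx]))
          (hext _ _ hA₁ hBD' (by simp [hE₁, ← hξB, hx])) fun x hx => hBB x (by simp [hx])
      · exact hF₀ B B' hB hB' (hext _ _ hA₀ hBD (by simp [hE₀, hx]))
          (hext _ _ hA₀ hBD' (by simp [hE₀, ← hξB, hx])) fun x hx => hBB x (by simp [hx])

theorem exists_run (hL : omegaSet ⊆ L.1) {s : Sq L} {D : M} (h : ¬ FinDet G s.app 0 (tr D))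
    (n : ℕ) : ∃ (s' : Sq L) (D' : M), Run G s'.app (tr D') n ∧ ¬ FinDet G s'.app n (tr D') := by
  induction n with
  | zero => exact ⟨s, D, fun k hk => absurd hk (Nat.not_lt_zero k), h⟩
  | succ n ih =>
    obtain ⟨s', D', hr, hf⟩ := ih
    exact exists_run_succ hL hr hf

theorem Run.unique (hL : ∀ x y : Lam L, x.1.1 ∈ y.1.1 ∨ x = y ∨ y.1.1 ∈ x.1.1) {m : ℕ}
    (h : Run G s D n) (h' : Run G s' D' m) (hk : k ≤ n) (hk' : k ≤ m) : Same s s' D D' k := by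
  induction k with
  | zero => exact fun i hi => absurd hi (Nat.not_lt_zero i)
  | succ k ih =>
    have hS := ih (by omega) (by omega)
    obtain ⟨h1, h2, h3⟩ := h k (by omega)
    obtain ⟨h1', h2', h3'⟩ := h' k (by omega)
    have hs : s k = s' k := by
      rcases hL (s k) (s' k) with hlt | heq | hlt
      · exact absurd ((hS.split_iff _).1 h1) (h2' _ hlt)
      · exact heq
      · exact absurd ((hS.split_iff _).2 h1') (h2 _ hlt)
    intro i hi
    rcases (Nat.lt_succ_iff.1 hi).lt_or_eq with hi | rfl
    · exact hS i hi
    · refine ⟨hs, ?_⟩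
      rw [h3, h3']
      refine exists_congr fun E => ?_
      have hE : Same s s' (tr E) (tr E) (i + 1) := fun j hj => by
        have : s j = s' j := by
          rcases (Nat.lt_succ_iff.1 hj).lt_or_eq with hj | rfl
          · exact (hS j hj).1
          · exact hs
        exact ⟨this, by rw [this]⟩
      have hE' : Agree s i (tr E) D ↔ Agree s' i (tr E) D' := hS.agree_iff _
      rw [hE.finDet_iff, hE', hs]

/-- Good sets are determined by their trace on some finite set. Otherwise there are runs of every
length; by uniqueness they cohere, and their limit yields a sequence `β` of `M` along which good
sets have their first change arbitrarily late. -/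
theorem finDet_zero (hL : omegaSet ⊆ L.1)
    (htri : ∀ x y : Lam L, x.1.1 ∈ y.1.1 ∨ x = y ∨ y.1.1 ∈ x.1.1) (s : Sq L) (D : M) :
    FinDet G s.app 0 (tr D) := by
  have : Fact (omegaSet ⊆ L.1) := ⟨hL⟩
  by_contra hfin
  choose t E hrun _ using exists_run hL hfin
  let α (n : ℕ) : Lam L := (t (n + 1)).app n
  let z (n : ℕ) : Prop := α n ∈ tr (E (n + 1))
  have huniq : ∀ {n m i : ℕ}, i < n → i < m →
      (t n).app i = (t m).app i ∧ ((t n).app i ∈ tr (E n) ↔ (t m).app i ∈ tr (E m)) :=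
    fun {n m i} hn hm => (hrun n).unique htri (hrun m) (k := i + 1) hn hm i i.lt_succ_self
  have hα : ∀ n, ∃ B, Good G B ∧ (∀ i < n, α i ∈ B ↔ z i) ∧ (α n ∈ B ↔ ¬ z n) := by
    intro n
    have hs := (hrun (n + 1) n n.lt_succ_self).1
    have hag : ∀ B, Agree (t (n + 1)).app n B (tr (E (n + 1))) → ∀ i < n, α i ∈ B ↔ z i := by
      intro B hB i hi
      have h := huniq (n := n + 1) (m := i + 1) (i := i) (by omega) (by omega)
      have h' := hB i hi
      rw [h.2, h.1] at h'
      exact h'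
    by_cases hz : z n
    · obtain ⟨B, hB, hBD, hξ⟩ := hs.2
      exact ⟨B, hB, hag B hBD, hξ.trans (by simp [hz])⟩
    · obtain ⟨B, hB, hBD, hξ⟩ := hs.1
      exact ⟨B, hB, hag B hBD, hξ.trans (by simp [hz])⟩
  -- One of the two bits `b` occurs infinitely often along the run.
  obtain ⟨b, hb⟩ : ∃ b : Prop, ∃ᶠ n in Filter.atTop, (z n ↔ b) := by
    by_contra! h
    obtain ⟨n, h1, h2⟩ := ((h True).and (h False)).exists
    tauto
  obtain ⟨n₀, hn₀⟩ := hb.exists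
  -- `β` lists the `α n` with bit `b`; the other places are filled with the fixed value `α n₀`.
  classical
  obtain ⟨β, hβ⟩ : ∃ β : Sq L, β.app = fun n => if z n ↔ b then α n else α n₀ := by
    refine @exists_sq _ _ _ hL _ ⟨Def.congr (Q := fun p : (Unit × ℕ) × Lam L =>
      ∃ (s : Sq L) (D : M), Run G s.app (tr D) (p.1.2 + 1) ∧
        (((s.app p.1.2 ∈ tr D ↔ b) ∧ s.app p.1.2 = p.2) ∨
          (¬ (s.app p.1.2 ∈ tr D ↔ b) ∧ α n₀ = p.2))) inferInstance ?_⟩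
    rintro ⟨⟨-, n⟩, ξ⟩
    have hn : ∀ (s : Sq L) (D : M), Run G s.app (tr D) (n + 1) →
        s.app n = α n ∧ (s.app n ∈ tr D ↔ z n) := fun s D hr =>
      hr.unique htri (hrun (n + 1)) le_rfl le_rfl n n.lt_succ_self
    constructor
    · intro h
      refine ⟨t (n + 1), E (n + 1), hrun (n + 1), ?_⟩
      change ((z n ↔ b) ∧ α n = ξ) ∨ (¬ (z n ↔ b) ∧ α n₀ = ξ)
      by_cases hz : z n ↔ b
      · exact Or.inl ⟨hz, by simpa [hz] using h⟩
      · exact Or.inr ⟨hz, by simpa [hz] using h⟩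
    · rintro ⟨s, D, hr, h⟩
      obtain ⟨h1, h2⟩ := hn s D hr
      simp only at h
      rw [h2, h1] at h
      rcases h with ⟨hz, h⟩ | ⟨hz, h⟩ <;> simp only [hz, if_true, if_false, h]
  obtain ⟨n, hn, hnb⟩ := Filter.frequently_atTop.1 hb (max (n₀ + 1) (G.val β + 1))
  obtain ⟨B, hB, hlt, heq⟩ := hα n
  have hn₀n : n₀ < n := lt_of_lt_of_le (Nat.lt_succ_self _) ((le_max_left _ _).trans hn)
  have hGn : G.val β < n := lt_of_lt_of_le (Nat.lt_succ_self _) ((le_max_right _ _).trans hn)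
  have hβlt : ∀ i < n, β.app i ∈ B ↔ b := by
    intro i hi
    rw [hβ]
    by_cases hz : z i ↔ b
    · simp only [hz, if_true]; rw [hlt i hi, hz]
    · simp only [hz, if_false]; rw [hlt n₀ hn₀n, hn₀]
  have hβn : β.app n ∈ B ↔ ¬ b := by
    rw [hβ]
    simp only [hnb, if_true]
    rw [heq, hnb]
  refine hB β n hGn ⟨fun i hi => ?_, ?_⟩
  · rw [hβlt i hi, hβlt 0 (by omega)]
  · rw [hβn, hβlt 0 (by omega)]
    tauto

/-- Good sets belong to `M`: such a set is the only good one with its trace on a suitable finite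
set. -/
theorem Good.exists_tr_eq (hL : omegaSet ⊆ L.1)
    (htri : ∀ x y : Lam L, x.1.1 ∈ y.1.1 ∨ x = y ∨ y.1.1 ∈ x.1.1) {A : Set (Lam L)}
    (hA : Good G A) : ∃ a : M, a.1 ⊆ L.1 ∧ tr a = A := by
  have : Fact (omegaSet ⊆ L.1) := ⟨hL⟩
  -- The empty condition; the parameters `s` and `L` in it play no role.
  obtain ⟨s, -⟩ := exists_cover hL ∅
  obtain ⟨F, hF⟩ := finDet_zero (G := G) hL htri s L
  obtain ⟨t, l, htl⟩ := exists_cover hL F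
  obtain ⟨E, hE⟩ := exists_tr_finite (F := A ∩ t.app '' Set.Iio l)
    (((Set.finite_Iio l).image _).inter_of_right _)
  have hAE : Agree t.app l A (tr E) := fun m hm => by
    rw [hE]; exact ⟨fun h => ⟨h, m, hm, rfl⟩, fun h => h.1⟩
  obtain ⟨a, haL, ha⟩ := exists_tr (fun ξ : Lam L => Side G t.app l (tr E) ξ True)
  refine ⟨a, haL, Set.ext fun ξ => (ha ξ).trans ⟨?_, fun hξ => ⟨A, hA, hAE, by simpa⟩⟩⟩
  rintro ⟨B, hB, hBE, hξ⟩
  refine hF B A hB hA (fun i hi => absurd hi (Nat.not_lt_zero i))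
    (fun i hi => absurd hi (Nat.not_lt_zero i)) (fun x hx => ?_) (hξ.2 trivial)
  obtain ⟨m, hm, rfl⟩ := htl x hx
  rw [hBE m hm, hAE m hm]

/-! ### The coding function -/

/-- The value at `j` of the set-theoretic function `x` is an element of `A`. -/
def ValueIn (A x : ZFSet.{u}) (j : ℕ) : Prop := ∃ y ∈ A, ZFSet.pair (natZ j) y ∈ x

/-- The first `j` such that exactly one of `x(0)`, `x(j)` is in `A`, and `0` if there is none. -/
noncomputable def changePlace (A x : ZFSet.{u}) : ℕ :=
  sInf {j | ¬ (ValueIn A x j ↔ ValueIn A x 0)}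

/-- The function `x ↦ changePlace A x` with domain `X`, as a set. -/
noncomputable def codeFun (A X : ZFSet.{u}) : ZFSet.{u} :=
  ZFSet.sep (fun p => ∃ x, p = ZFSet.pair x (natZ (changePlace A x))) (ZFSet.prod X omegaSet)

theorem pair_mem_codeFun {A X x y : ZFSet.{u}} :
    ZFSet.pair x y ∈ codeFun A X ↔ x ∈ X ∧ y = natZ (changePlace A x) := by
  rw [codeFun, ZFSet.mem_sep, ZFSet.pair_mem_prod]
  constructor
  · rintro ⟨⟨hx, -⟩, x', h⟩
    obtain ⟨rfl, rfl⟩ := ZFSet.pair_inj.1 h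
    exact ⟨hx, rfl⟩
  · rintro ⟨hx, rfl⟩
    exact ⟨⟨hx, mem_omegaSet.2 ⟨_, rfl⟩⟩, x, rfl⟩

theorem isFunc_codeFun (A X : ZFSet.{u}) : ZFSet.IsFunc X omegaSet (codeFun A X) :=
  ⟨ZFSet.sep_subset, fun _ hx => ⟨_, pair_mem_codeFun.2 ⟨hx, rfl⟩,
    fun _ hy => (pair_mem_codeFun.1 hy).2⟩⟩

theorem mem_cardSet_trichotomy {lam : Cardinal.{u}} {x y : ZFSet.{u}} (hx : x ∈ cardSet lam)
    (hy : y ∈ cardSet lam) : x ∈ y ∨ x = y ∨ y ∈ x := by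
  obtain ⟨a, -, rfl⟩ := Ordinal.mem_toZFSet_iff.1 hx
  obtain ⟨b, -, rfl⟩ := Ordinal.mem_toZFSet_iff.1 hy
  simpa [Ordinal.toZFSet_injective.eq_iff] using lt_trichotomy a b

theorem omegaSet_subset_cardSet {lam : Cardinal.{u}} (hlam : Cardinal.aleph0 ≤ lam) :
    omegaSet ⊆ cardSet lam :=
  Ordinal.toZFSet_subset_toZFSet_iff.2 (by simpa using Cardinal.ord_le_ord.2 hlam)

/-- A function `g ∈ M` on the sequences of `M` with values in `ω`, as a `Bound`. -/
theorem exists_bound {g : ZFSet.{u}} (hg : g ∈ M)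
    (hf : ZFSet.IsFunc (funsIn M omegaSet L.1) omegaSet g) :
    ∃ G : Bound L, ∀ s : Sq L, ZFSet.pair s.1.1 (natZ (G.val s)) ∈ g := by
  have h : ∀ s : Sq L, ∃ n, ∀ m, ZFSet.pair s.1.1 (natZ m) ∈ g ↔ n = m := by
    intro s
    obtain ⟨y, hy, hyu⟩ := hf.2 s.1.1 (ZFSet.mem_sep.2 ⟨ZFSet.mem_funs.2 s.2, s.1.2⟩)
    obtain ⟨n, rfl⟩ := mem_omegaSet.1 (ZFSet.pair_mem_prod.1 (hf.1 hy)).2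
    exact ⟨n, fun m => ⟨fun hm => (natZ_injective (hyu _ hm)).symm, fun hm => hm ▸ hy⟩⟩
  choose G hG using h
  refine ⟨⟨G, ⟨Def.congr (Q := fun p : (Unit × Sq L) × ℕ =>
    (pr (M := M) (Srt.enc p.1.2) (Srt.enc p.2)).1 ∈ (⟨g, hg⟩ : M).1) inferInstance
    fun p => ?_⟩⟩, fun s => (hG s _).2 rfl⟩
  change G p.1.2 = p.2 ↔ ZFSet.pair p.1.2.1.1 (natZ p.2) ∈ g
  exact (hG _ _).symm

theorem valueIn_iff {A : ZFSet.{u}} {s : Sq L} {j : ℕ} :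
    ValueIn A s.1.1 j ↔ (s.app j).1.1 ∈ A := by
  constructor
  · rintro ⟨y, hy, hp⟩
    have hyL := (ZFSet.pair_mem_prod.1 (s.2.1 hp)).2
    have : s.app j = ⟨⟨y, IsModel.trans _ L.2 _ hyL⟩, hyL⟩ := Sq.app_eq_iff.2 hp
    rw [this]
    exact hy
  · exact fun h => ⟨_, h, Sq.app_eq_iff.1 rfl⟩

end Runs

end SetModel

open SetModel in
theorem mainTheorem3 (lam : Cardinal.{u}) (hlam : Cardinal.aleph0 ≤ lam)
    (A : ZFSet.{u}) (hA : A ⊆ SetModel.cardSet lam) :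
    ∃ f : ZFSet.{u},
      ZFSet.IsFunc (ZFSet.funs SetModel.omegaSet (SetModel.cardSet lam)) SetModel.omegaSet f ∧
      ∀ M : Set ZFSet.{u}, SetModel.IsTransitiveModelZF M → SetModel.cardSet lam ∈ M →
        (∃ g ∈ M,
          ZFSet.IsFunc (SetModel.funsIn M SetModel.omegaSet (SetModel.cardSet lam))
            SetModel.omegaSet g ∧
          SetModel.DominatedOn
            (SetModel.funsIn M SetModel.omegaSet (SetModel.cardSet lam)) f g) →
        A ∈ M := by
  refine ⟨codeFun A _, isFunc_codeFun A _, ?_⟩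
  rintro M hM hl ⟨g, hg, hgf, hdom⟩
  have := hM.isModel hlam hl
  let L : M := ⟨cardSet lam, hl⟩
  obtain ⟨G, hG⟩ := exists_bound (L := L) hg hgf
  have hgood : Good G {x : Lam L | x.1.1 ∈ A} := by
    intro β j hj hβ
    have hmem : β.1.1 ∈ ZFSet.funs omegaSet (cardSet lam) := ZFSet.mem_funs.2 β.2
    have hle := natZ_subset_natZ.1 (hdom β.1.1 (ZFSet.mem_sep.2 ⟨hmem, β.1.2⟩) _ _
      (pair_mem_codeFun.2 ⟨hmem, rfl⟩) (hG β))
    -- Past `G β` the first change would be the value of the coding function, which `g` bounds.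
    have hset : IsLeast {j | ¬ (ValueIn A β.1.1 j ↔ ValueIn A β.1.1 0)} j := by
      simp only [valueIn_iff]
      exact ⟨hβ.2, fun i hi => not_lt.1 fun h => hi (hβ.1 i h)⟩
    rw [changePlace, hset.csInf_eq] at hle
    omega
  obtain ⟨a, haL, ha⟩ := hgood.exists_tr_eq (omegaSet_subset_cardSet hlam) fun x y =>
    (mem_cardSet_trichotomy x.2 y.2).imp_right (Or.imp_left fun h => Subtype.ext (Subtype.ext h))
  have : a.1 = A := by
    ext x
    by_cases hx : x ∈ cardSet lam
    · exact Set.ext_iff.1 ha (⟨⟨x, hM.transitive _ hl _ hx⟩, hx⟩ : Lam L)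
    · exact iff_of_false (fun h => hx (haL h)) fun h => hx (hA h)
  exact this ▸ a.2
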